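/- Let $n\ge 1$ and let $\mathbb{H}^n=\{x\in\mathbb{R}^{n+1}: x_0^2-x_1^2-\cdots-x_n^2=1,\ x_0>0\}$ be the hyperbolic space, with geodesic distance $d(x,y)=\cosh^{-1}(x_0y_0-x_1y_1-\cdots-x_ny_n)$, canonical volume measure $dx$ (in polar coordinates $x=(\cosh\theta,\sinh\theta\,\xi)$, $\theta>0$, $\xi\in\mathbb{S}^{n-1}$: $dx=\sinh^{n-1}\theta\,d\theta\,d\sigma(\xi)$) and vertex $v=(1,0,\dots,0)$. Let $\mathcal{P}(\mathbb{H}^n)$ be the set of Borel probability measures on $\mathbb{H}^n$. For $K:[0,\infty)\to\mathbb{R}\cup\{+\infty\}$ and $\rho\in\mathcal{P}(\mathbb{H}^n)$ define the interaction energy $$E[\rho]=\frac12\iint_{\mathbb{H}^n\times\mathbb{H}^n}K(d(x,y))\,d\rho(x)\,d\rho(y)\in\mathbb{R}\cup\{+\infty\}.$$ Assume that 1. there is a finite constant $K_{\min}<0$ with $K\ge K_{\min}$ on $[0,\infty)$; 2. $\int_{d(x,v)<R}|K(d(x,v))|\,dx<\infty$ for every $R>0$; 3. the interaction is radial, i.e.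 it is given by $K(d(x,y))$ as above; 4. the limit $K_\infty=\lim_{\theta\to\infty}K(\theta)\in\mathbb{R}\cup\{+\infty\}$ exists, and $E[\rho]<\frac12K_\infty$ for some $\rho\in\mathcal{P}(\mathbb{H}^n)$; 5. $K$ is lower semicontinuous on $[0,\infty)$; 6. there is $R_6>0$ such that $K$ is strictly increasing on $[R_6,\infty)$. Then $E$ has a global minimizer in $\mathcal{P}(\mathbb{H}^n)$. Moreover, there is a constant $D>0$, depending only on $K$ and $n$, such that every global minimizer of $E$ in $\mathcal{P}(\mathbb{H}^n)$ has compact support whose diameter (with respect to $d$) is at most $D$. -/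

import Mathlib

open MeasureTheory Filter Topology
open scoped NNReal ENNReal

/-- The Lorentzian inner product `x₀ y₀ - x₁ y₁ - ⋯ - xₙ yₙ` on `ℝⁿ⁺¹`. -/
def lorentz {n : ℕ} (x y : Fin (n + 1) → ℝ) : ℝ :=
  x 0 * y 0 - ∑ i : Fin n, x i.succ * y i.succ

/-- The hyperboloid model of the `n`-dimensional hyperbolic space. -/
def HypSpace (n : ℕ) : Type :=
  {x : Fin (n + 1) → ℝ // lorentz x x = 1 ∧ 0 < x 0}

namespace HypSpace

/-- The manifold topology of the hyperboloid: the one induced from `ℝⁿ⁺¹`. -/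
instance instTopologicalSpace (n : ℕ) : TopologicalSpace (HypSpace n) :=
  inferInstanceAs (TopologicalSpace {x : Fin (n + 1) → ℝ // lorentz x x = 1 ∧ 0 < x 0})

/-- The Borel sigma-algebra. -/
instance instMeasurableSpace (n : ℕ) : MeasurableSpace (HypSpace n) := borel (HypSpace n)

instance instBorelSpace (n : ℕ) : BorelSpace (HypSpace n) := ⟨rfl⟩

theorem one_le_lorentz {n : ℕ} (x y : HypSpace n) : 1 ≤ lorentz x.1 y.1 := by
  obtain ⟨x, hx, hx0⟩ := x
  obtain ⟨y, hy, hy0⟩ := y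
  simp only [lorentz] at hx hy ⊢
  have hcs := Finset.sum_mul_sq_le_sq_mul_sq Finset.univ
    (fun i : Fin n => x i.succ) (fun i : Fin n => y i.succ)
  simp only [pow_two] at hcs
  set p := ∑ i : Fin n, x i.succ * y i.succ
  set a := ∑ i : Fin n, x i.succ * x i.succ with ha
  set b := ∑ i : Fin n, y i.succ * y i.succ with hb
  have ha0 : 0 ≤ a := Finset.sum_nonneg fun i _ => mul_self_nonneg _
  have hb0 : 0 ≤ b := Finset.sum_nonneg fun i _ => mul_self_nonneg _
  have hxa : x 0 * x 0 = 1 + a := by linarith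
  have hyb : y 0 * y 0 = 1 + b := by linarith
  have hab : 2 * p ≤ a + b := by nlinarith [sq_nonneg (a - b), sq_nonneg (a + b - 2 * p)]
  have hsq : (1 + p) ^ 2 ≤ (x 0 * y 0) ^ 2 := by
    have : (x 0 * y 0) ^ 2 = (1 + a) * (1 + b) := by rw [← hxa, ← hyb]; ring
    rw [this]; nlinarith
  linarith [(abs_le.mp (abs_le_of_sq_le_sq hsq (by positivity))).2]

/-- The geodesic distance `d(x, y) = arcosh ⟨x, y⟩`. -/
noncomputable def geodDist {n : ℕ} (x y : HypSpace n) : ℝ≥0 :=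
  ⟨Real.arcosh (lorentz x.1 y.1), Real.arcosh_nonneg (one_le_lorentz x y)⟩

/-- The vertex `v = (1, 0, …, 0)`. -/
def vertex (n : ℕ) : HypSpace n :=
  ⟨Fin.cons 1 0, by simp [lorentz], by simp⟩

/-- Hyperbolic polar coordinates `(θ, ξ) ↦ (cosh θ, sinh θ • ξ)`. -/
noncomputable def polar (n : ℕ) (p : ℝ × Metric.sphere (0 : EuclideanSpace ℝ (Fin n)) 1) :
    HypSpace n :=
  ⟨Fin.cons (Real.cosh p.1) fun i => Real.sinh p.1 * p.2.1 i, by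
    have h : ∑ i, p.2.1 i * p.2.1 i = 1 := by
      have h1 : ‖p.2.1‖ = 1 := by simp
      have h2 := EuclideanSpace.real_norm_sq_eq p.2.1
      rw [h1] at h2
      simp only [← pow_two]
      linarith
    have h' : ∑ i, Real.sinh p.1 * p.2.1 i * (Real.sinh p.1 * p.2.1 i) = Real.sinh p.1 ^ 2 := by
      calc _ = Real.sinh p.1 ^ 2 * ∑ i, p.2.1 i * p.2.1 i := by
            rw [Finset.mul_sum]
            exact Finset.sum_congr rfl fun i _ => by ring
        _ = _ := by rw [h, mul_one]
    simp only [lorentz, Fin.cons_zero, Fin.cons_succ, h']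
    nlinarith [Real.cosh_sq p.1], by simpa using Real.cosh_pos p.1⟩

/-- The canonical Riemannian volume of the hyperbolic space, for `1 ≤ n`:
in polar coordinates, `dx = sinhⁿ⁻¹ θ dθ dσ(ξ)`, where `σ` is the surface measure of the unit
sphere. -/
noncomputable def vol (n : ℕ) : Measure (HypSpace n) :=
  Measure.map (polar n)
    (((volume.restrict (Set.Ioi (0 : ℝ))).withDensity
        fun θ => ENNReal.ofReal (Real.sinh θ ^ (n - 1))).prod
      (volume : Measure (EuclideanSpace ℝ (Fin n))).toSphere)

end HypSpace

/-- The integral of an extended real function: integral of the positive part minus integral of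
the negative part. It is the usual one whenever the latter is finite (in particular for functions
bounded from below and finite measures). -/
noncomputable def extIntegral {X : Type*} [MeasurableSpace X] (μ : Measure X) (f : X → EReal) :
    EReal :=
  ((∫⁻ x, (f x).toENNReal ∂μ : ℝ≥0∞) : EReal) - ((∫⁻ x, (-f x).toENNReal ∂μ : ℝ≥0∞) : EReal)

/-- The interaction energy `E[ρ] = (1/2) ∬ K(d(x, y)) dρ(x) dρ(y)`. -/
noncomputable def interactionEnergy {n : ℕ} (K : ℝ≥0 → EReal)
    (ρ : ProbabilityMeasure (HypSpace n)) : EReal :=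
  ((1 / 2 : ℝ) : EReal) *
    extIntegral ((ρ : Measure (HypSpace n)).prod (ρ : Measure (HypSpace n)))
      fun p => K (HypSpace.geodDist p.1 p.2)

/-- `ρ` minimizes the energy among all Borel probability measures on the hyperbolic space. -/
def IsGlobalMinimizer {n : ℕ} (K : ℝ≥0 → EReal) (ρ : ProbabilityMeasure (HypSpace n)) : Prop :=
  ∀ σ : ProbabilityMeasure (HypSpace n), interactionEnergy K ρ ≤ interactionEnergy K σ

/-- `K` is bounded from below by a finite negative constant. In particular `K` does not take the
value `-∞`. -/
def BoundedFromBelow (K : ℝ≥0 → EReal) : Prop :=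
  ∃ Kmin : ℝ, Kmin < 0 ∧ ∀ θ, (Kmin : EReal) ≤ K θ

/-- `K` is locally integrable on the `n`-dimensional hyperbolic space: the integral of
`|K(d(x, v))|` over each ball `d(x, v) < R` is finite. -/
def LocallyIntegrableOnHyp (n : ℕ) (K : ℝ≥0 → EReal) : Prop :=
  ∀ R : ℝ, 0 < R →
    ∫⁻ x in {x : HypSpace n | (HypSpace.geodDist x (HypSpace.vertex n) : ℝ) < R},
      (K (HypSpace.geodDist x (HypSpace.vertex n))).abs ∂(HypSpace.vol n) < ∞

/-- The limit of `K` at infinity exists (possibly `+∞`), and some probability measure on the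
`n`-dimensional hyperbolic space has energy below half of this limit. -/
def HasLimitAndUnstable (n : ℕ) (K : ℝ≥0 → EReal) : Prop :=
  ∃ Kinf : EReal, Tendsto K atTop (𝓝 Kinf) ∧
    ∃ ρ : ProbabilityMeasure (HypSpace n), interactionEnergy K ρ < ((1 / 2 : ℝ) : EReal) * Kinf

/-- `K` is strictly increasing on some half-line `[R₆, ∞)` with `R₆ > 0`. -/
def EventuallyStrictlyIncreasing (K : ℝ≥0 → EReal) : Prop :=
  ∃ R₆ : ℝ≥0, 0 < R₆ ∧ StrictMonoOn K (Set.Ici R₆)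

/-! Subtracting a lower bound of `K` leaves a kernel `h ∘ d` with values in `[0, ∞]` and changes the
energy by an increasing affine map. Let `I` be the infimum of the new pair energy. Instability gives
`I < A` and `t` with `h ≥ A` on `[t, ∞)`, and this gap drives everything.

Masses `a`, `b` on sets at distance at least `t` cost at least `I (a² + b²) + 2 A a b = I (a + b)² +
2 (A - I) a b`, so near-minimizers cannot split. A light annulus separates a ball from a tail, so a
near-minimizer charging a ball has a uniformly small tail (`exists_tail_le`). A heavy ball exists
because a mean potential below `A` forces mass near some point (`exists_mem_le_measureReal`).

Existence: recenter a minimizing sequence by isometries, get tightness, apply Prokhorov and lower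
semicontinuity. Support: by the first variation (`setLIntegral_le_of_minimizer`) every support point
of a minimizer is near a heavy ball, and two distant heavy balls contradict the tail bound. -/

/-- The double integral `∬ k(x, y) dμ(x) dμ(y)` of a nonnegative kernel. -/
noncomputable def pairEnergy {X : Type*} [MeasurableSpace X] (k : X → X → ℝ≥0∞) (μ : Measure X) :
    ℝ≥0∞ :=
  ∫⁻ p, k p.1 p.2 ∂μ.prod μ

/-- The infimum of the pair energy over probability measures. -/
noncomputable def minPairEnergy {X : Type*} [MeasurableSpace X] (k : X → X → ℝ≥0∞) : ℝ≥0∞ :=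
  ⨅ ρ : ProbabilityMeasure X, pairEnergy k (ρ : Measure X)

/-! ### Pair energies of nonnegative symmetric kernels. -/

section Kernel

variable {X : Type*} [MeasurableSpace X] {k : X → X → ℝ≥0∞}

theorem minPairEnergy_le (μ : Measure X) [hμ : IsProbabilityMeasure μ] :
    minPairEnergy k ≤ pairEnergy k μ :=
  iInf_le (fun ρ : ProbabilityMeasure X => pairEnergy k (ρ : Measure X)) ⟨μ, hμ⟩

theorem pairEnergy_smul (c : ℝ≥0∞) (μ : Measure X) [SFinite μ] [SFinite (c • μ)] :
    pairEnergy k (c • μ) = c ^ 2 * pairEnergy k μ := by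
  unfold pairEnergy
  rw [Measure.prod_smul_left, Measure.prod_smul_right, lintegral_smul_measure,
    lintegral_smul_measure, smul_eq_mul, smul_eq_mul, pow_two, mul_assoc]

/-- The energy is quadratic in the measure, so one normalizes. This lets unnormalized pieces and
competitors be compared with the infimum. -/
theorem minPairEnergy_mul_sq_le (μ : Measure X) [IsFiniteMeasure μ] :
    minPairEnergy k * μ Set.univ ^ 2 ≤ pairEnergy k μ := by
  rcases eq_or_ne (μ Set.univ) 0 with h0 | h0
  · simp [h0]
  have hμ : NeZero μ := ⟨fun h => h0 (by simp [h])⟩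
  have htop : μ Set.univ ≠ ∞ := measure_ne_top _ _
  have hfin : IsFiniteMeasure ((μ Set.univ)⁻¹ • μ) := inferInstance
  have h := minPairEnergy_le (k := k) ((μ Set.univ)⁻¹ • μ)
  rw [pairEnergy_smul] at h
  calc _ ≤ ((μ Set.univ)⁻¹ ^ 2 * pairEnergy k μ) * μ Set.univ ^ 2 := by gcongr
    _ = ((μ Set.univ)⁻¹ * μ Set.univ) ^ 2 * pairEnergy k μ := by ring
    _ = _ := by rw [ENNReal.inv_mul_cancel h0 htop, one_pow, one_mul]

theorem setLIntegral_prod_swap (hsymm : ∀ x y, k x y = k y x) (ρ : Measure X) [SFinite ρ]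
    (S T : Set X) :
    ∫⁻ p in S ×ˢ T, k p.1 p.2 ∂ρ.prod ρ = ∫⁻ p in T ×ˢ S, k p.1 p.2 ∂ρ.prod ρ := by
  rw [← Measure.prod_restrict, ← Measure.prod_restrict,
    ← lintegral_prod_swap (μ := ρ.restrict S) (ν := ρ.restrict T)]
  exact lintegral_congr fun p => hsymm _ _

theorem pairEnergy_restrict_eq (ρ : Measure X) [SFinite ρ] (S : Set X) :
    pairEnergy k (ρ.restrict S) = ∫⁻ p in S ×ˢ S, k p.1 p.2 ∂ρ.prod ρ := by
  rw [pairEnergy, Measure.prod_restrict]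

/-- Interaction of two disjoint parts. -/
theorem pairEnergy_restrict_add_le (hsymm : ∀ x y, k x y = k y x) (ρ : Measure X) [SFinite ρ]
    {S T : Set X}
    (hS : MeasurableSet S) (hT : MeasurableSet T) (hST : Disjoint S T) :
    pairEnergy k (ρ.restrict S) + pairEnergy k (ρ.restrict T) +
      2 * ∫⁻ p in S ×ˢ T, k p.1 p.2 ∂ρ.prod ρ ≤ pairEnergy k ρ := by
  have h1 : Disjoint (S ×ˢ S) (T ×ˢ T) := Set.disjoint_prod.2 (Or.inl hST)
  have h2 : Disjoint (S ×ˢ T) (T ×ˢ S) := Set.disjoint_prod.2 (Or.inl hST)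
  have h3 : Disjoint (S ×ˢ S ∪ T ×ˢ T) (S ×ˢ T ∪ T ×ˢ S) := by
    simp only [Set.disjoint_union_left, Set.disjoint_union_right, Set.disjoint_prod]
    exact ⟨⟨Or.inr hST, Or.inl hST.symm⟩, ⟨Or.inl hST, Or.inr hST.symm⟩⟩
  rw [pairEnergy_restrict_eq, pairEnergy_restrict_eq, two_mul]
  -- The fourth integral is the second copy of the cross term; moved to `T ×ˢ S`, it makes the four
  -- domains pairwise disjoint.
  nth_rewrite 4 [setLIntegral_prod_swap hsymm]
  rw [← lintegral_union (hT.prod hT) h1, ← lintegral_union (hT.prod hS) h2,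
    ← lintegral_union ((hS.prod hT).union (hT.prod hS)) h3]
  exact setLIntegral_le_lintegral _ _

/-- Lower bound for the energy of a measure that charges two sets with large interaction. -/
theorem le_pairEnergy_of_disjoint (hsymm : ∀ x y, k x y = k y x) (ρ : Measure X) [IsFiniteMeasure ρ]
    {S T : Set X}
    (hS : MeasurableSet S) (hT : MeasurableSet T) (hST : Disjoint S T) {A : ℝ≥0∞}
    (hA : ∀ x ∈ S, ∀ y ∈ T, A ≤ k x y) :
    minPairEnergy k * ρ S ^ 2 + minPairEnergy k * ρ T ^ 2 + 2 * (A * (ρ S * ρ T)) ≤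
      pairEnergy k ρ := by
  refine le_trans ?_ (pairEnergy_restrict_add_le hsymm ρ hS hT hST)
  gcongr
  · simpa using minPairEnergy_mul_sq_le (k := k) (ρ.restrict S)
  · simpa using minPairEnergy_mul_sq_le (k := k) (ρ.restrict T)
  · rw [← Measure.prod_prod, ← setLIntegral_const]
    exact setLIntegral_mono' (hS.prod hT) fun p hp => hA _ hp.1 _ hp.2

/-- Bilinearity and symmetry make the energy a quadratic polynomial in `u`; with `S = Tᶜ` this is
the family of competitors for the first variation. -/
theorem pairEnergy_restrict_add_smul (hsymm : ∀ x y, k x y = k y x) (ρ : Measure X) [IsFiniteMeasure ρ]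
    (S T : Set X) (u : ℝ≥0) :
    pairEnergy k (ρ.restrict S + u • ρ.restrict T) =
      pairEnergy k (ρ.restrict S) + 2 * (u * ∫⁻ p in S ×ˢ T, k p.1 p.2 ∂ρ.prod ρ) +
        u ^ 2 * pairEnergy k (ρ.restrict T) := by
  have hu : (u • ρ.restrict T) = (u : ℝ≥0∞) • ρ.restrict T := rfl
  have : IsFiniteMeasure ((u : ℝ≥0∞) • ρ.restrict T) := by rw [← hu]; infer_instance
  rw [hu, ← pairEnergy_smul]
  simp only [pairEnergy]
  rw [Measure.add_prod, Measure.prod_add, Measure.prod_add]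
  simp only [lintegral_add_measure, Measure.prod_smul_left, Measure.prod_smul_right,
    lintegral_smul_measure, smul_eq_mul, Measure.prod_restrict]
  rw [setLIntegral_prod_swap hsymm ρ T S]
  ring

/-- First variation of the pair energy at a minimizer. -/
theorem setLIntegral_le_of_minimizer (hsymm : ∀ x y, k x y = k y x) (ρ : Measure X)
    [IsProbabilityMeasure ρ] (hI : minPairEnergy k ≠ ∞) (hρ : pairEnergy k ρ = minPairEnergy k)
    {T : Set X} (hT : MeasurableSet T) :
    ∫⁻ p in T ×ˢ Set.univ, k p.1 p.2 ∂ρ.prod ρ ≤ minPairEnergy k * ρ T := by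
  have hsplit : ∫⁻ p in T ×ˢ Set.univ, k p.1 p.2 ∂ρ.prod ρ =
      (∫⁻ p in Tᶜ ×ˢ T, k p.1 p.2 ∂ρ.prod ρ) + pairEnergy k (ρ.restrict T) := by
    rw [setLIntegral_prod_swap hsymm ρ Tᶜ T, pairEnergy_restrict_eq,
      ← lintegral_union (hT.prod hT) (Set.disjoint_prod.2 (Or.inr disjoint_compl_left)),
      ← Set.prod_union, Set.compl_union_self]
  have hone : pairEnergy k ρ = pairEnergy k (ρ.restrict Tᶜ) +
      2 * (∫⁻ p in Tᶜ ×ˢ T, k p.1 p.2 ∂ρ.prod ρ) + pairEnergy k (ρ.restrict T) := by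
    have := pairEnergy_restrict_add_smul hsymm ρ Tᶜ T 1
    simpa [Measure.restrict_compl_add_restrict hT] using this
  -- The competitor rescales `ρ` on `T` by `u = 1 - s`; its mass is `1 - s * ρ T`, and the quadratic
  -- bound replaces normalization.
  have hvar (u : ℝ≥0) := minPairEnergy_mul_sq_le (k := k) (ρ.restrict Tᶜ + u • ρ.restrict T)
  simp only [pairEnergy_restrict_add_smul hsymm] at hvar
  rw [hsplit]
  have hab : ρ Tᶜ + ρ T = 1 := by rw [add_comm, prob_add_prob_compl hT]
  rw [hρ] at hone
  set Q := ∫⁻ p in Tᶜ ×ˢ T, k p.1 p.2 ∂ρ.prod ρ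
  set V := pairEnergy k (ρ.restrict T)
  set P := pairEnergy k (ρ.restrict Tᶜ)
  have hV : V ≠ ∞ := fun h => hI (by rw [hone, h]; simp)
  have hP : P ≠ ∞ := fun h => hI (by rw [hone, h]; simp)
  have hQ : Q ≠ ∞ := fun h => hI (by rw [hone, h]; simp)
  have ha : ρ Tᶜ ≠ ∞ := measure_ne_top _ _
  have hb : ρ T ≠ ∞ := measure_ne_top _ _
  simp only [Measure.coe_add, Measure.coe_nnreal_smul_apply, Pi.add_apply,
    Measure.restrict_apply_univ] at hvar
  generalize minPairEnergy k = I at *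
  generalize ρ T = b at *
  generalize ρ Tᶜ = a at *
  clear_value P Q V
  lift I to ℝ≥0 using hI
  lift P to ℝ≥0 using hP
  lift Q to ℝ≥0 using hQ
  lift V to ℝ≥0 using hV
  lift a to ℝ≥0 using ha
  lift b to ℝ≥0 using hb
  norm_cast at *
  rw [← NNReal.coe_le_coe]
  replace hone := congrArg (fun x : ℝ≥0 => (x : ℝ)) hone
  replace hab := congrArg (fun x : ℝ≥0 => (x : ℝ)) hab
  push_cast at hone hab ⊢
  by_contra! hlt
  set c : ℝ := Q + V - I * b with hc
  have hc0 : 0 < c := by linarith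
  -- Comparison with the competitor will give `2 s c ≤ s² V`; a small `s` violates it. The `V + 1`
  -- avoids dividing by zero.
  obtain ⟨s, hs0, hs1, hsV⟩ : ∃ s : ℝ, 0 < s ∧ s ≤ 1 ∧ s * V < 2 * c := by
    refine ⟨min 1 (c / (V + 1)), lt_min one_pos (by positivity), min_le_left _ _, ?_⟩
    have h1 : min 1 (c / (V + 1)) * (V : ℝ) ≤ c / (V + 1) * V := by
      gcongr
      exact min_le_right _ _
    have h2 : c / (V + 1) * (V : ℝ) ≤ c := by
      rw [div_mul_eq_mul_div, div_le_iff₀ (by positivity)]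
      nlinarith
    linarith
  have h := hvar (1 - s).toNNReal
  rw [← NNReal.coe_le_coe] at h
  push_cast at h
  rw [Real.coe_toNNReal _ (by linarith)] at h
  have hI0 : (0 : ℝ) ≤ I := I.2
  have key : 2 * s * c ≤ s ^ 2 * V := by
    have ha' : (a : ℝ) = 1 - b := by linarith
    rw [ha'] at h
    have e : (1 - (b : ℝ) + (1 - s) * b) = 1 - s * b := by ring
    rw [e] at h
    nlinarith [mul_nonneg hI0 (sq_nonneg (s * (b : ℝ)))]
  nlinarith

end Kernel

/-! ### Weak lower semicontinuity. -/

/-- Superlevel sets of `f` are open, so the layer cake formula and Fatou's lemma give the bound.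
Truncation at `N` makes `f` real-valued for the layer cake formula. -/
theorem lintegral_le_liminf_lintegral_of_lowerSemicontinuous {Ω : Type*} [MeasurableSpace Ω]
    [TopologicalSpace Ω] [OpensMeasurableSpace Ω] {μ : Measure Ω} {μs : ℕ → Measure Ω}
    {f : Ω → ℝ≥0∞} (hf : LowerSemicontinuous f)
    (h_opens : ∀ G, IsOpen G → μ G ≤ atTop.liminf fun i => μs i G) :
    ∫⁻ x, f x ∂μ ≤ atTop.liminf fun i => ∫⁻ x, f x ∂μs i := by
  have hsup (x : Ω) : f x = ⨆ N : ℕ, min (f x) N := by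
    refine le_antisymm ?_ (iSup_le fun N => min_le_left _ _)
    rcases eq_or_ne (f x) ∞ with h | h
    · simp [h, ENNReal.iSup_natCast]
    · obtain ⟨N, hN⟩ := ENNReal.exists_nat_gt h
      exact le_iSup_of_le N (le_min le_rfl hN.le)
  have hmeas (N : ℕ) : Measurable fun x => min (f x) (N : ℝ≥0∞) :=
    hf.measurable.min measurable_const
  rw [lintegral_congr hsup, lintegral_iSup hmeas
    fun a b hab x => min_le_min le_rfl (Nat.cast_le.2 hab)]
  refine iSup_le fun N => ?_
  set g : Ω → ℝ := fun x => (min (f x) (N : ℝ≥0∞)).toReal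
  have hne (x : Ω) : min (f x) (N : ℝ≥0∞) ≠ ∞ :=
    ((min_le_right _ _).trans_lt (ENNReal.natCast_lt_top N)).ne
  have hg (x : Ω) : min (f x) (N : ℝ≥0∞) = ENNReal.ofReal (g x) :=
    (ENNReal.ofReal_toReal (hne x)).symm
  have hgm : Measurable g := (hmeas N).ennreal_toReal
  have hopen (t : ℝ) (ht : 0 < t) : IsOpen {x | t < g x} := by
    have : {x | t < g x} = {x | ENNReal.ofReal t < f x} ∩ {_x | ENNReal.ofReal t < N} := by
      ext x
      simp only [Set.mem_ofPred_eq, Set.mem_inter_iff, g]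
      rw [← ENNReal.ofReal_lt_iff_lt_toReal ht.le (hne x), lt_min_iff]
    rw [this]
    exact (hf.isOpen_preimage _).inter isOpen_const
  calc _ = ∫⁻ t in Set.Ioi (0 : ℝ), μ {x | t < g x} := by
        rw [lintegral_congr hg]
        exact lintegral_eq_lintegral_meas_lt μ (Eventually.of_forall fun _ => ENNReal.toReal_nonneg)
          hgm.aemeasurable
    _ ≤ ∫⁻ t in Set.Ioi (0 : ℝ), atTop.liminf fun i => μs i {x | t < g x} :=
        setLIntegral_mono' measurableSet_Ioi fun t ht => h_opens _ (hopen t ht)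
    _ ≤ atTop.liminf fun i => ∫⁻ t in Set.Ioi (0 : ℝ), μs i {x | t < g x} :=
        lintegral_liminf_le fun i => Antitone.measurable fun s t hst =>
          measure_mono fun x hx => lt_of_le_of_lt hst hx
    _ = atTop.liminf fun i => ∫⁻ x, min (f x) N ∂μs i := by
        congr 1
        ext i
        rw [lintegral_congr hg]
        exact (lintegral_eq_lintegral_meas_lt _ (Eventually.of_forall fun _ => ENNReal.toReal_nonneg)
          hgm.aemeasurable).symm
    _ ≤ _ := liminf_le_liminf (Eventually.of_forall fun i => lintegral_mono fun x => min_le_left _ _)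

/-- The pair energy of a lower semicontinuous kernel is weakly lower semicontinuous. -/
theorem pairEnergy_le_liminf {X : Type*} [TopologicalSpace X] [MeasurableSpace X] [BorelSpace X]
    [SecondCountableTopology X] [TopologicalSpace.MetrizableSpace X] {k : X → X → ℝ≥0∞}
    (hk : LowerSemicontinuous fun p : X × X => k p.1 p.2) {ρ : ProbabilityMeasure X}
    {ρs : ℕ → ProbabilityMeasure X} (h : Tendsto ρs atTop (𝓝 ρ)) :
    pairEnergy k (ρ : Measure X) ≤ atTop.liminf fun i => pairEnergy k (ρs i : Measure X) := by
  let _ : MetricSpace X := TopologicalSpace.metrizableSpaceMetric X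
  have hprod : Tendsto (fun i => (ρs i).prod (ρs i)) atTop (𝓝 (ρ.prod ρ)) :=
    (ProbabilityMeasure.continuous_prod.tendsto (ρ, ρ)).comp (h.prodMk_nhds h)
  exact lintegral_le_liminf_lintegral_of_lowerSemicontinuous hk fun G hG =>
    ProbabilityMeasure.le_liminf_measure_open_of_tendsto hprod hG

/-! ### Concentration and existence on a homogeneous proper space. -/

/-- `d` is a continuous distance function with compact balls, whose isometries act transitively. -/
structure IsHomogeneousProperDist {X : Type*} [TopologicalSpace X] (d : X → X → ℝ≥0) : Prop where
  continuous : Continuous fun p : X × X => d p.1 p.2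
  self : ∀ x, d x x = 0
  symm : ∀ x y, d x y = d y x
  triangle : ∀ x y z, d x z ≤ d x y + d y z
  isCompact_ball : ∀ x R, IsCompact {y | d x y ≤ R}
  transitive : ∀ x y, ∃ f : X → X, Continuous f ∧ f x = y ∧ ∀ z w, d (f z) (f w) = d z w

namespace IsHomogeneousProperDist

variable {X : Type*} [TopologicalSpace X] [MeasurableSpace X] [BorelSpace X]
  {d : X → X → ℝ≥0} {h : ℝ≥0 → ℝ≥0∞}

omit [MeasurableSpace X] [BorelSpace X] in
theorem continuous_left (hd : IsHomogeneousProperDist d) (x : X) : Continuous (d x) :=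
  hd.continuous.comp (Continuous.prodMk_right x)

theorem measurableSet_le (hd : IsHomogeneousProperDist d) (x : X) (R : ℝ≥0) :
    MeasurableSet {y | d x y ≤ R} :=
  (isClosed_le (hd.continuous_left x) continuous_const).measurableSet

theorem measurableSet_lt (hd : IsHomogeneousProperDist d) (x : X) (R : ℝ≥0) :
    MeasurableSet {y | R < d x y} :=
  (isOpen_lt continuous_const (hd.continuous_left x)).measurableSet

theorem measureReal_lt (hd : IsHomogeneousProperDist d) (ρ : Measure X) [IsProbabilityMeasure ρ]
    (x : X) (R : ℝ≥0) : ρ.real {y | R < d x y} = 1 - ρ.real {y | d x y ≤ R} := by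
  rw [← probReal_compl_eq_one_sub (hd.measurableSet_le x R)]
  congr 1
  ext y
  simp

/-- Some annulus among `N` consecutive ones has mass at most `1 / N`. -/
theorem exists_annulus (hd : IsHomogeneousProperDist d) (ρ : Measure X) [IsProbabilityMeasure ρ]
    (x : X) (r t : ℝ≥0) {N : ℕ} (hN : 0 < N) : ∃ i < N,
      1 - 1 / (N : ℝ) ≤ ρ.real {y | d x y ≤ r + i * t} + ρ.real {y | r + (i + 1) * t < d x y} := by
  by_contra! hcon
  -- If every annulus had mass above `1 / N`, telescoping would give `F N - F 0 > 1`.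
  set F : ℕ → ℝ := fun i => ρ.real {y | d x y ≤ r + i * t}
  have hstep : ∀ i ∈ Finset.range N, 1 / (N : ℝ) < F (i + 1) - F i := by
    intro i hi
    have := hcon i (Finset.mem_range.1 hi)
    rw [hd.measureReal_lt] at this
    simp only [F]
    push_cast
    linarith
  have hsum := Finset.sum_lt_sum_of_nonempty (Finset.nonempty_range_iff.2 hN.ne') hstep
  rw [Finset.sum_range_sub, Finset.sum_const, Finset.card_range, nsmul_eq_mul,
    mul_one_div_cancel (by positivity)] at hsum
  have h0 : 0 ≤ F 0 := measureReal_nonneg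
  have h1 : F N ≤ 1 := measureReal_le_one
  linarith

/-- Nearly minimizing measures that charge a ball have uniformly small tails. -/
theorem exists_tail_le (hd : IsHomogeneousProperDist d) {I A : ℝ≥0}
    (hI : minPairEnergy (fun x y => h (d x y)) = I) (hIA : I < A) {t : ℝ≥0}
    (hA : ∀ s, t ≤ s → A ≤ h s) (r : ℝ≥0) {m δ : ℝ} (hm : 0 < m) (hδ : 0 < δ) :
    ∃ η : ℝ≥0, 0 < η ∧ ∃ R : ℝ≥0, ∀ (ρ : Measure X) [IsProbabilityMeasure ρ] (x : X),
      pairEnergy (fun x y => h (d x y)) ρ ≤ I + η → m ≤ ρ.real {y | d x y ≤ r} →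
        ρ.real {y | R < d x y} ≤ δ := by
  have hIA' : (0 : ℝ) < A - I := sub_pos.2 hIA
  -- `κ` is both the energy slack and a bound for the annulus loss `2 I / N`; its value makes `(A -
  -- I) m b ≤ κ` read `b ≤ δ`.
  set κ : ℝ := (A - I) * m * δ
  have hκ : 0 < κ := by positivity
  obtain ⟨N, hN⟩ := exists_nat_gt (max 1 (2 * I / κ))
  have hN1 : (1 : ℝ) < N := (le_max_left _ _).trans_lt hN
  have hN0 : 0 < N := by exact_mod_cast one_pos.trans hN1
  have hNI : 2 * I * (1 / (N : ℝ)) ≤ κ := by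
    have := (div_lt_iff₀ hκ).1 ((le_max_right _ _).trans_lt hN)
    rw [mul_one_div, div_le_iff₀ (by positivity)]
    linarith
  refine ⟨κ.toNNReal, Real.toNNReal_pos.2 hκ, r + N * t, fun ρ _ x hρ hmx => ?_⟩
  obtain ⟨i, hiN, hi⟩ := hd.exists_annulus ρ x r t hN0
  set S := {y | d x y ≤ r + i * t}
  set T := {y | r + (i + 1) * t < d x y}
  have hST : Disjoint S T := by
    refine Set.disjoint_left.2 fun y hy hy' => ?_
    have h1 : r + i * t ≤ r + (i + 1) * t := by gcongr; simp
    exact absurd hy (not_le.2 (h1.trans_lt hy'))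
  have hAST : ∀ y ∈ S, ∀ z ∈ T, (A : ℝ≥0∞) ≤ h (d y z) := by
    intro y hy z hz
    refine hA _ ?_
    have h1 := hd.triangle x y z
    have h2 : d x y ≤ r + i * t := hy
    have h3 : r + (i + 1) * t < d x z := hz
    rw [← NNReal.coe_le_coe] at h1 h2 ⊢
    rw [← NNReal.coe_lt_coe] at h3
    push_cast at h1 h2 h3
    linarith
  have hE := (le_pairEnergy_of_disjoint (fun y z => by rw [hd.symm]) ρ (hd.measurableSet_le _ _)
    (hd.measurableSet_lt _ _) hST hAST).trans hρ
  rw [hI] at hE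
  have hSm : m ≤ ρ.real S := hmx.trans (measureReal_mono fun y (hy : d x y ≤ r) =>
    show d x y ≤ r + i * t from hy.trans le_self_add)
  have hRT : ρ.real {y | r + N * t < d x y} ≤ ρ.real T := by
    refine measureReal_mono fun y hy => ?_
    have : r + (i + 1 : ℝ≥0) * t ≤ r + N * t := by
      gcongr
      exact_mod_cast hiN
    exact this.trans_lt hy
  refine hRT.trans ?_
  rw [← ENNReal.ofReal_toReal (measure_ne_top ρ S), ← ENNReal.ofReal_toReal (measure_ne_top ρ T)]
    at hE
  change 1 - 1 / (N : ℝ) ≤ ρ.real S + ρ.real T at hi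
  change (I : ℝ≥0∞) * ENNReal.ofReal (ρ.real S) ^ 2 + I * ENNReal.ofReal (ρ.real T) ^ 2 +
    2 * (A * (ENNReal.ofReal (ρ.real S) * ENNReal.ofReal (ρ.real T))) ≤ _ at hE
  have ha0 : 0 ≤ ρ.real S := measureReal_nonneg
  have hb0 : 0 ≤ ρ.real T := measureReal_nonneg
  generalize ρ.real S = a at *
  generalize ρ.real T = b at *
  lift a to ℝ≥0 using ha0
  lift b to ℝ≥0 using hb0
  simp only [ENNReal.ofReal_coe_nnreal] at hE
  norm_cast at hE
  rw [← NNReal.coe_le_coe] at hE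
  push_cast at hE
  rw [Real.coe_toNNReal _ hκ.le] at hE
  have hI0 : (0 : ℝ) ≤ I := I.2
  have hNN : 1 / (N : ℝ) ≤ 1 := by
    rw [div_le_one (by positivity)]
    exact hN1.le
  have hsq : 1 - 2 * (1 / (N : ℝ)) ≤ ((a : ℝ) + b) ^ 2 := by
    have := pow_le_pow_left₀ (sub_nonneg.2 hNN) hi 2
    linarith [sq_nonneg (1 / (N : ℝ)), sub_sq 1 (1 / (N : ℝ))]
  -- From `I (a + b)² + 2 (A - I) a b ≤ I + κ` and `(a + b)² ≥ 1 - 2 / N`, one gets `2 (A - I) a b ≤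
  -- κ + 2 I / N ≤ 2 κ`.
  have h1 : (A - I) * (a * b) ≤ κ := by nlinarith [mul_le_mul_of_nonneg_left hsq hI0]
  have h2 : (A - I) * (m * b) ≤ κ := by
    refine le_trans ?_ h1
    gcongr
  have h3 : (A - I) * m * b ≤ (A - I) * m * δ := by linarith
  exact le_of_mul_le_mul_left h3 (by positivity)

theorem measurable_kernel (hd : IsHomogeneousProperDist d) [SecondCountableTopology X]
    (hh : Measurable h) : Measurable fun p : X × X => h (d p.1 p.2) :=
  hh.comp hd.continuous.measurable

/-- If the mean potential on `T` is below the interaction at infinity, some point of `T` is the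
center of a ball of definite mass. -/
theorem exists_mem_le_measureReal (hd : IsHomogeneousProperDist d) [SecondCountableTopology X]
    (hh : Measurable h) {E A : ℝ≥0} (hEA : E < A) {t : ℝ≥0} (hA : ∀ s, t ≤ s → A ≤ h s)
    (ρ : Measure X) [IsProbabilityMeasure ρ] {T : Set X} (hT : ρ T ≠ 0)
    (hρ : ∫⁻ p in T ×ˢ Set.univ, h (d p.1 p.2) ∂ρ.prod ρ ≤ E * ρ T) :
    ∃ x ∈ T, 1 - E / A ≤ ρ.real {y | d x y ≤ t} := by
  have hm := hd.measurable_kernel hh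
  rw [← Measure.prod_restrict, Measure.restrict_univ, lintegral_prod _ hm.aemeasurable] at hρ
  obtain ⟨x, hxT, hx⟩ := exists_le_setLAverage hT (measure_ne_top ρ T)
    (Measurable.lintegral_prod_right (ν := ρ) (f := fun y z => h (d y z)) hm).aemeasurable
  refine ⟨x, hxT, ?_⟩
  have hx' : ∫⁻ y, h (d x y) ∂ρ ≤ E := by
    refine hx.trans ?_
    rw [setLAverage_eq]
    exact ENNReal.div_le_of_le_mul hρ
  -- Markov's inequality: outside the ball of radius `t` the kernel is at least `A`.
  have hlow : (A : ℝ≥0∞) * ρ {y | t < d x y} ≤ E := by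
    refine le_trans ?_ hx'
    rw [← setLIntegral_const]
    exact (setLIntegral_mono' (hd.measurableSet_lt x t) fun y hy => hA _ (le_of_lt hy)).trans
      (setLIntegral_le_lintegral _ _)
  have hlow' := ENNReal.toReal_mono ENNReal.coe_ne_top hlow
  rw [ENNReal.toReal_mul] at hlow'
  change (A : ℝ) * ρ.real {y | t < d x y} ≤ E at hlow'
  rw [hd.measureReal_lt] at hlow'
  have hA0 : (0 : ℝ) < A := lt_of_le_of_lt E.2 hEA
  have := (le_div_iff₀' hA0).2 hlow'
  linarith

/-- The support of a minimizer has uniformly bounded diameter. -/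
theorem exists_support_bound (hd : IsHomogeneousProperDist d) [SecondCountableTopology X]
    (hh : Measurable h) {I A : ℝ≥0} (hI : minPairEnergy (fun x y => h (d x y)) = I)
    (hIA : I < A) {t : ℝ≥0} (hA : ∀ s, t ≤ s → A ≤ h s) :
    ∃ D : ℝ≥0, 0 < D ∧ ∀ (ρ : Measure X) [IsProbabilityMeasure ρ],
      pairEnergy (fun x y => h (d x y)) ρ = I →
        ∀ x ∈ ρ.support, ∀ y ∈ ρ.support, d x y ≤ D := by
  have hA0 : (0 : ℝ) < A := lt_of_le_of_lt I.2 hIA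
  have hm : (0 : ℝ) < 1 - I / A := by
    rw [sub_pos, div_lt_one hA0]
    exact hIA
  -- A tail of half the mass `1 - I / A` cannot contain a heavy ball. The radius `t + 1` absorbs the
  -- move from a support point to a nearby good center.
  obtain ⟨η, -, R, hR⟩ := hd.exists_tail_le hI hIA hA (t + 1) hm (half_pos hm)
  refine ⟨R + (t + 1), by positivity, fun ρ _ hρ x hx y hy => ?_⟩
  have hball : ∀ z ∈ ρ.support, 1 - (I : ℝ) / A ≤ ρ.real {w | d z w ≤ t + 1} := by
    intro z hz
    set T := {w | d z w < 1}
    have hTo : IsOpen T := isOpen_lt (hd.continuous_left z) continuous_const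
    have hzT : z ∈ T := by
      change d z z < 1
      rw [hd.self]
      exact one_pos
    have hT := (ρ.mem_support_iff_forall z).1 hz T (hTo.mem_nhds hzT)
    have hvar := setLIntegral_le_of_minimizer (k := fun x y => h (d x y))
      (fun y z => by rw [hd.symm]) ρ (by simp [hI]) (by rw [hρ, hI]) hTo.measurableSet
    rw [hI] at hvar
    obtain ⟨w, hw, hwm⟩ := hd.exists_mem_le_measureReal hh hIA hA ρ hT.ne' hvar
    refine hwm.trans (measureReal_mono fun u hu => ?_)
    calc d z u ≤ d z w + d w u := hd.triangle z w u
      _ ≤ 1 + t := add_le_add (le_of_lt hw) hu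
      _ = t + 1 := add_comm _ _
  by_contra! hlt
  have htail := hR ρ x (by rw [hρ]; exact le_self_add) (hball x hx)
  have hsub : {w | d y w ≤ t + 1} ⊆ {w | R < d x w} := by
    intro w hw
    have h1 := hd.triangle x w y
    rw [hd.symm w y] at h1
    have h2 : R + (t + 1) < d x w + (t + 1) := hlt.trans_le (h1.trans (by gcongr; exact hw))
    exact lt_of_add_lt_add_right h2
  have := (hball y hy).trans (measureReal_mono hsub)
  linarith

omit [BorelSpace X] in
theorem isCompact_support (hd : IsHomogeneousProperDist d) {ρ : Measure X} {D : ℝ≥0}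
    (hD : ∀ x ∈ ρ.support, ∀ y ∈ ρ.support, d x y ≤ D) : IsCompact ρ.support := by
  rcases ρ.support.eq_empty_or_nonempty with he | ⟨x, hx⟩
  · rw [he]
    exact isCompact_empty
  · exact (hd.isCompact_ball x D).of_isClosed_subset Measure.isClosed_support fun y hy => hD x hx y hy

/-- A probability measure can be recentered by an isometry, without changing its energy. -/
theorem exists_recenter (hd : IsHomogeneousProperDist d) [SecondCountableTopology X]
    (hh : Measurable h) (ρ : ProbabilityMeasure X) (x v : X) (r : ℝ≥0) :
    ∃ σ : ProbabilityMeasure X,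
      pairEnergy (fun x y => h (d x y)) (σ : Measure X) =
        pairEnergy (fun x y => h (d x y)) (ρ : Measure X) ∧
      (ρ : Measure X).real {y | d x y ≤ r} = (σ : Measure X).real {y | d v y ≤ r} := by
  obtain ⟨f, hf, hfx, hfd⟩ := hd.transitive x v
  have hfm := hf.measurable
  refine ⟨ρ.map hfm.aemeasurable, ?_, ?_⟩
  · rw [ProbabilityMeasure.toMeasure_map, pairEnergy, Measure.map_prod_map _ _ hfm hfm,
      lintegral_map (hd.measurable_kernel hh) (hfm.prodMap hfm)]
    exact lintegral_congr fun p => by simp [hfd]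
  · rw [ProbabilityMeasure.toMeasure_map, map_measureReal_apply hfm (hd.measurableSet_le v r)]
    congr 1
    ext y
    simp [← hfx, hfd]

/-- Existence of a minimizer of the pair energy when the infimum lies below the interaction at
infinity. -/
theorem exists_pairEnergy_eq_min (hd : IsHomogeneousProperDist d) [PolishSpace X] (v : X)
    (hh : LowerSemicontinuous h) {I A : ℝ≥0} (hI : minPairEnergy (fun x y => h (d x y)) = I)
    (hIA : I < A) {t : ℝ≥0} (hA : ∀ s, t ≤ s → A ≤ h s) :
    ∃ ρ : ProbabilityMeasure X, pairEnergy (fun x y => h (d x y)) (ρ : Measure X) = I := by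
  -- An energy bound `E < A` along the whole sequence gives a heavy ball of mass independent of `j`.
  obtain ⟨E, hIE, hEA⟩ := exists_between hIA
  have hA0 : (0 : ℝ) < A := lt_of_le_of_lt E.2 hEA
  have hm : (0 : ℝ) < 1 - E / A := by
    rw [sub_pos, div_lt_one hA0]
    exact hEA
  obtain ⟨u, -, hu, hulim⟩ := exists_seq_strictAnti_tendsto' hIE
  have hseq (j : ℕ) : ∃ σ : ProbabilityMeasure X,
      pairEnergy (fun x y => h (d x y)) (σ : Measure X) ≤ u j ∧
        1 - E / A ≤ (σ : Measure X).real {y | d v y ≤ t} := by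
    have hlt : minPairEnergy (fun x y => h (d x y)) < (u j : ℝ≥0∞) := by
      rw [hI]
      exact_mod_cast (hu j).1
    obtain ⟨ρ, hρ⟩ := iInf_lt_iff.1 hlt
    have hρE : pairEnergy (fun x y => h (d x y)) (ρ : Measure X) ≤ E :=
      hρ.le.trans (by exact_mod_cast (hu j).2.le)
    obtain ⟨x, -, hx⟩ := hd.exists_mem_le_measureReal hh.measurable hEA hA (ρ : Measure X)
      (T := Set.univ) (by simp) (by simpa [pairEnergy] using hρE)
    obtain ⟨σ, hσ, hσb⟩ := hd.exists_recenter hh.measurable ρ x v t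
    exact ⟨σ, hσ ▸ hρ.le, hσb ▸ hx⟩
  choose σ hσE hσm using hseq
  have htight : IsTightMeasureSet {((μ : ProbabilityMeasure X) : Measure X) | μ ∈ Set.range σ} := by
    rw [isTightMeasureSet_iff_exists_isCompact_measure_compl_le]
    intro ε hε
    obtain ⟨δ, hδ, hδε⟩ := ENNReal.lt_iff_exists_nnreal_btwn.1 hε
    have hδ0 : (0 : ℝ) < δ := by exact_mod_cast hδ
    obtain ⟨η, hη, R, hR⟩ := hd.exists_tail_le hI hIA hA t hm hδ0
    obtain ⟨J, hJ⟩ := (hulim.eventually_le_const (lt_add_of_pos_right I hη)).exists_forall_of_atTop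
    -- The tail bound applies only once the energy is within `η` of `I`; each of the finitely many
    -- earlier measures is tight by itself.
    have hsingle (j : ℕ) : ∃ K : Set X, IsCompact K ∧ (σ j : Measure X) Kᶜ ≤ ε := by
      obtain ⟨K, hK, hK'⟩ := isTightMeasureSet_iff_exists_isCompact_measure_compl_le.1
        (isTightMeasureSet_singleton (μ := (σ j : Measure X))) ε hε
      exact ⟨K, hK, hK' _ rfl⟩
    choose K hK hKε using hsingle
    refine ⟨{y | d v y ≤ R} ∪ ⋃ j ∈ Set.Iio J, K j,
      (hd.isCompact_ball v R).union ((Set.finite_Iio J).isCompact_biUnion fun j _ => hK j), ?_⟩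
    rintro _ ⟨_, ⟨j, rfl⟩, rfl⟩
    rcases lt_or_ge j J with hj | hj
    · refine (measure_mono ?_).trans (hKε j)
      exact Set.compl_subset_compl.2 ((Set.subset_biUnion_of_mem (u := K) (Set.mem_Iio.2 hj)).trans
        Set.subset_union_right)
    · have hsub : ({y | d v y ≤ R} ∪ ⋃ j ∈ Set.Iio J, K j)ᶜ ⊆ {y | R < d v y} :=
        fun y hy => show R < d v y from not_le.1 fun hle => hy (Or.inl hle)
      refine (measure_mono hsub).trans (le_trans ?_ hδε.le)
      have h1 := hR (σ j : Measure X) v ((hσE j).trans (by exact_mod_cast hJ j hj)) (hσm j)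
      rw [measureReal_def] at h1
      exact (ENNReal.le_ofReal_iff_toReal_le (measure_ne_top _ _) hδ0.le).2 h1 |>.trans_eq
        (ENNReal.ofReal_coe_nnreal)
  let _ : MetricSpace X := TopologicalSpace.metrizableSpaceMetric X
  obtain ⟨ρ, -, φ, hφ, hlim⟩ := (isCompact_closure_of_isTightMeasureSet htight).tendsto_subseq
    fun j => subset_closure (Set.mem_range_self j)
  refine ⟨ρ, le_antisymm ?_ (hI ▸ minPairEnergy_le _)⟩
  have hlsc : LowerSemicontinuous fun p : X × X => h (d p.1 p.2) := hh.comp hd.continuous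
  have hu' : Tendsto (fun j => (u (φ j) : ℝ≥0∞)) atTop (𝓝 I) :=
    ENNReal.tendsto_coe.2 (hulim.comp hφ.tendsto_atTop)
  calc _ ≤ _ := pairEnergy_le_liminf hlsc hlim
    _ ≤ atTop.liminf fun j => (u (φ j) : ℝ≥0∞) :=
      liminf_le_liminf (Eventually.of_forall fun j => hσE (φ j))
    _ = I := hu'.liminf_eq

end IsHomogeneousProperDist

/-! ### Lorentzian linear algebra. -/

section Lorentz

variable {n : ℕ} (x y z : Fin (n + 1) → ℝ) (c : ℝ)

theorem lorentz_comm : lorentz x y = lorentz y x := by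
  simp only [lorentz, mul_comm]

theorem lorentz_add_left : lorentz (x + y) z = lorentz x z + lorentz y z := by
  simp only [lorentz, Pi.add_apply, add_mul, Finset.sum_add_distrib]
  ring

theorem lorentz_smul_left : lorentz (c • x) y = c * lorentz x y := by
  simp only [lorentz, Pi.smul_apply, smul_eq_mul, mul_assoc, ← Finset.mul_sum]
  ring

theorem lorentz_neg_left : lorentz (-x) y = -lorentz x y := by
  rw [← neg_one_smul ℝ x, lorentz_smul_left, neg_one_mul]

theorem lorentz_add_right : lorentz x (y + z) = lorentz x y + lorentz x z := by
  rw [lorentz_comm, lorentz_add_left, lorentz_comm y, lorentz_comm z]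

theorem lorentz_smul_right : lorentz x (c • y) = c * lorentz x y := by
  rw [lorentz_comm, lorentz_smul_left, lorentz_comm]

theorem lorentz_neg_right : lorentz x (-y) = -lorentz x y := by
  rw [lorentz_comm, lorentz_neg_left, lorentz_comm]

theorem continuous_lorentz :
    Continuous fun p : (Fin (n + 1) → ℝ) × (Fin (n + 1) → ℝ) => lorentz p.1 p.2 := by
  unfold lorentz
  fun_prop

/-- The point reflection of the Lorentz space with axis spanned by `p`. -/
noncomputable def lorentzReflection (p z : Fin (n + 1) → ℝ) : Fin (n + 1) → ℝ :=
  -z + (2 * lorentz z p / lorentz p p) • p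

/-- The map fixes `p` and is `-1` on its Lorentz-orthogonal complement. -/
theorem lorentz_lorentzReflection {p : Fin (n + 1) → ℝ} (hp : lorentz p p ≠ 0) :
    lorentz (lorentzReflection p y) (lorentzReflection p z) = lorentz y z := by
  simp only [lorentzReflection, lorentz_add_left, lorentz_add_right, lorentz_neg_left,
    lorentz_neg_right, lorentz_smul_left, lorentz_smul_right, lorentz_comm p z]
  field_simp
  ring

theorem continuous_lorentzReflection (p : Fin (n + 1) → ℝ) : Continuous (lorentzReflection p) := by
  unfold lorentzReflection lorentz
  fun_prop

end Lorentz

/-! ### The hyperboloid as a homogeneous proper space. -/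

namespace HypSpace

variable {n : ℕ}

theorem continuous_val : Continuous fun x : HypSpace n => x.1 := continuous_subtype_val

theorem one_le_zero (x : HypSpace n) : 1 ≤ x.1 0 := by
  have h := one_le_lorentz x (vertex n)
  simpa [lorentz, vertex] using h

theorem lorentz_vertex (x : HypSpace n) : lorentz (vertex n).1 x.1 = x.1 0 := by
  simp [lorentz, vertex]

/-- The open condition `0 < x 0` improves to the closed one `1 ≤ x 0` on the quadric. -/
theorem isClosed_hyperboloid :
    IsClosed {x : Fin (n + 1) → ℝ | lorentz x x = 1 ∧ 0 < x 0} := by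
  have h : {x : Fin (n + 1) → ℝ | lorentz x x = 1 ∧ 0 < x 0} =
      {x | lorentz x x = 1} ∩ {x | 1 ≤ x 0} := by
    ext x
    exact ⟨fun hx => ⟨hx.1, one_le_zero ⟨x, hx⟩⟩, fun hx => ⟨hx.1, one_pos.trans_le hx.2⟩⟩
  rw [h]
  exact (isClosed_eq (continuous_lorentz.comp (continuous_id.prodMk continuous_id))
    continuous_const).inter (isClosed_le continuous_const (continuous_apply 0))

instance instPolishSpace : PolishSpace (HypSpace n) :=
  isClosed_hyperboloid.polishSpace

theorem cosh_geodDist (x y : HypSpace n) : Real.cosh (geodDist x y) = lorentz x.1 y.1 :=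
  Real.cosh_arcosh (one_le_lorentz x y)

theorem geodDist_le_iff (x y : HypSpace n) {r : ℝ} (hr : 0 ≤ r) :
    (geodDist x y : ℝ) ≤ r ↔ lorentz x.1 y.1 ≤ Real.cosh r := by
  rw [← cosh_geodDist, Real.cosh_le_cosh, abs_of_nonneg hr, abs_of_nonneg (NNReal.coe_nonneg _)]

theorem continuous_geodDist : Continuous fun p : HypSpace n × HypSpace n => geodDist p.1 p.2 := by
  refine Continuous.subtype_mk ?_ _
  refine Real.continuousOn_arcosh.comp_continuous ?_ fun p => one_le_lorentz p.1 p.2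
  exact continuous_lorentz.comp
    ((continuous_val.comp continuous_fst).prodMk (continuous_val.comp continuous_snd))

theorem geodDist_self (x : HypSpace n) : geodDist x x = 0 := by
  rw [← NNReal.coe_eq_zero]
  exact (Real.arcosh_eq_zero_iff (one_le_lorentz x x)).2 x.2.1

theorem geodDist_comm (x y : HypSpace n) : geodDist x y = geodDist y x := by
  ext
  simp [geodDist, lorentz_comm x.1]

/-- The point reflection exchanging `x` and `y`. -/
theorem exists_isometry (x y : HypSpace n) : ∃ f : HypSpace n → HypSpace n,
    Continuous f ∧ f x = y ∧ ∀ z w, lorentz (f z).1 (f w).1 = lorentz z.1 w.1 := by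
  have hxy := one_le_lorentz x y
  -- The axis passes through the midpoint of `x` and `y`.
  set p := x.1 + y.1
  have hpp : lorentz p p = 2 * (1 + lorentz x.1 y.1) := by
    simp only [p, lorentz_add_left, lorentz_add_right, x.2.1, y.2.1, lorentz_comm y.1 x.1]
    ring
  have hp : lorentz p p ≠ 0 := by
    rw [hpp]
    positivity
  have hx : lorentzReflection p x.1 = y.1 := by
    have h : 2 * lorentz x.1 p / lorentz p p = 1 := by
      rw [div_eq_one_iff_eq hp, hpp, lorentz_add_right, x.2.1]
    rw [lorentzReflection, h, one_smul]
    simp [p]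
  have hmem (z : HypSpace n) : lorentz (lorentzReflection p z.1) (lorentzReflection p z.1) = 1 ∧
      0 < lorentzReflection p z.1 0 := by
    have h1 : lorentz (lorentzReflection p z.1) (lorentzReflection p z.1) = 1 := by
      rw [lorentz_lorentzReflection _ _ hp, z.2.1]
    refine ⟨h1, ?_⟩
    -- On the lower sheet `-w` would be a point of the space, so `⟨-w, y⟩ ≥ 1`, while `⟨w, y⟩ = ⟨z,
    -- x⟩ ≥ 1`.
    by_contra! hle
    set w := lorentzReflection p z.1 with hw
    have hw0 : w 0 ≠ 0 := by
      intro h0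
      have hs : 0 ≤ ∑ i : Fin n, w i.succ * w i.succ :=
        Finset.sum_nonneg fun i _ => mul_self_nonneg _
      rw [lorentz, h0] at h1
      linarith
    have hneg : lorentz (-w) (-w) = 1 ∧ 0 < (-w) 0 := by
      refine ⟨by rw [lorentz_neg_left, lorentz_neg_right, neg_neg, h1], ?_⟩
      simpa using lt_of_le_of_ne hle hw0
    have h2 := one_le_lorentz ⟨-w, hneg⟩ y
    have h3 : lorentz w y.1 = lorentz z.1 x.1 := by
      rw [hw, ← hx, lorentz_lorentzReflection _ _ hp]
    have h4 := one_le_lorentz z x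
    rw [lorentz_neg_left, h3] at h2
    linarith
  refine ⟨fun z => ⟨lorentzReflection p z.1, hmem z⟩, ?_, Subtype.ext hx, fun z w => ?_⟩
  · exact Continuous.subtype_mk ((continuous_lorentzReflection p).comp continuous_val) _
  · exact lorentz_lorentzReflection _ _ hp

/-- The hyperbolic sine of the distance to the vertex is the Euclidean norm of the spatial part, so
the addition formula for `cosh` reduces this to Cauchy–Schwarz. Homogeneity then moves any middle
point to the vertex. -/
theorem geodDist_triangle_vertex (x z : HypSpace n) :
    geodDist x z ≤ geodDist x (vertex n) + geodDist (vertex n) z := by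
  rw [geodDist_comm x (vertex n), ← NNReal.coe_le_coe, geodDist_le_iff _ _ (NNReal.coe_nonneg _),
    NNReal.coe_add, Real.cosh_add, cosh_geodDist, cosh_geodDist]
  have hsinh (y : HypSpace n) : Real.sinh (geodDist (vertex n) y) =
      √(∑ i : Fin n, y.1 i.succ ^ 2) := by
    rw [eq_comm, Real.sqrt_eq_iff_mul_self_eq (Finset.sum_nonneg fun i _ => sq_nonneg _)
      (Real.sinh_nonneg_iff.2 (NNReal.coe_nonneg _)), ← pow_two, Real.sinh_sq, cosh_geodDist,
      lorentz_vertex]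
    have := y.2.1
    simp only [lorentz, ← pow_two] at this
    linarith
  rw [hsinh, hsinh, lorentz_vertex, lorentz_vertex]
  have hcs := Real.sum_mul_le_sqrt_mul_sqrt Finset.univ (fun i : Fin n => -x.1 i.succ)
    fun i => z.1 i.succ
  simp only [neg_mul, Finset.sum_neg_distrib, neg_sq] at hcs
  rw [lorentz]
  linarith

theorem exists_geodDist_isometry (x y : HypSpace n) :
    ∃ f : HypSpace n → HypSpace n, Continuous f ∧ f x = y ∧
      ∀ z w, geodDist (f z) (f w) = geodDist z w := by
  obtain ⟨f, hf, hfx, hfd⟩ := exists_isometry x y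
  exact ⟨f, hf, hfx, fun z w => by ext; simp [geodDist, hfd]⟩

theorem geodDist_triangle (x y z : HypSpace n) : geodDist x z ≤ geodDist x y + geodDist y z := by
  obtain ⟨f, -, hfy, hfd⟩ := exists_geodDist_isometry y (vertex n)
  rw [← hfd x z, ← hfd x y, ← hfd y z, hfy]
  exact geodDist_triangle_vertex _ _

theorem isCompact_geodDist_vertex_le (R : ℝ≥0) :
    IsCompact {y : HypSpace n | geodDist (vertex n) y ≤ R} := by
  have hemb : IsClosedEmbedding fun x : HypSpace n => x.1 :=
    isClosed_hyperboloid.isClosedEmbedding_subtypeVal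
  have hK : IsCompact (Metric.closedBall (0 : Fin (n + 1) → ℝ) (Real.cosh R)) :=
    isCompact_closedBall _ _
  refine (hemb.isCompact_preimage hK).of_isClosed_subset
    (isClosed_le (continuous_geodDist.comp (Continuous.prodMk_right _)) continuous_const) ?_
  intro y hy
  have hy0 : y.1 0 ≤ Real.cosh R := by
    rw [← lorentz_vertex]
    exact (geodDist_le_iff _ _ R.2).1 hy
  have h1 := one_le_zero y
  have hn := y.2.1
  simp only [lorentz] at hn
  rw [Set.mem_preimage, mem_closedBall_zero_iff, pi_norm_le_iff_of_nonneg (Real.cosh_pos _).le]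
  intro i
  rw [Real.norm_eq_abs]
  refine le_trans ?_ hy0
  refine Fin.cases ?_ (fun j => ?_) i
  · rw [abs_of_nonneg (by linarith)]
  · have hj : y.1 j.succ * y.1 j.succ ≤ ∑ i : Fin n, y.1 i.succ * y.1 i.succ :=
      Finset.single_le_sum (f := fun i : Fin n => y.1 i.succ * y.1 i.succ)
        (fun i _ => mul_self_nonneg _) (Finset.mem_univ j)
    exact abs_le_of_sq_le_sq (by nlinarith) (by linarith)

end HypSpace

namespace HypSpace

variable {n : ℕ}

theorem isHomogeneousProperDist_geodDist :
    IsHomogeneousProperDist (geodDist : HypSpace n → HypSpace n → ℝ≥0) where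
  continuous := continuous_geodDist
  self := geodDist_self
  symm := geodDist_comm
  triangle := geodDist_triangle
  transitive := exists_geodDist_isometry
  isCompact_ball x R := by
    refine (isCompact_geodDist_vertex_le (geodDist (vertex n) x + R)).of_isClosed_subset
      (isClosed_le (continuous_geodDist.comp (Continuous.prodMk_right x)) continuous_const) ?_
    exact fun y (hy : geodDist x y ≤ R) => show geodDist (vertex n) y ≤ _ from
      (geodDist_triangle _ x y).trans (by gcongr)

end HypSpace

/-! ### Reduction to a nonnegative kernel, and the theorem. -/

/-- The part of an extended real valued kernel above a lower bound `c`. -/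
noncomputable def shiftedKernel (K : ℝ≥0 → EReal) (c : ℝ) (θ : ℝ≥0) : ℝ≥0∞ :=
  (K θ - c).toENNReal

/-- Integrate `(f - c) + f⁻ = f⁺ + (-c)`, an identity in `[0, ∞]` without subtraction of integrals;
`f⁻ ≤ -c` keeps the negative part finite. -/
theorem extIntegral_eq_lintegral_add {X : Type*} [MeasurableSpace X] (μ : Measure X)
    [IsProbabilityMeasure μ] {f : X → EReal} (hf : Measurable f) {c : ℝ} (hc : c ≤ 0)
    (hfc : ∀ x, (c : EReal) ≤ f x) :
    extIntegral μ f = ((∫⁻ x, (f x - c).toENNReal ∂μ : ℝ≥0∞) : EReal) + c := by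
  have hneg : ∫⁻ x, (-f x).toENNReal ∂μ ≤ ENNReal.ofReal (-c) := by
    calc _ ≤ ∫⁻ _, ENNReal.ofReal (-c) ∂μ := by
          refine lintegral_mono fun x => ?_
          rw [← EReal.real_coe_toENNReal, EReal.coe_neg]
          exact EReal.toENNReal_le_toENNReal (EReal.neg_le_neg_iff.2 (hfc x))
      _ = _ := by simp
  have hpt (x : X) : (f x - c).toENNReal + (-f x).toENNReal =
      (f x).toENNReal + ENNReal.ofReal (-c) := by
    have h := hfc x
    generalize f x = y at h ⊢
    induction y with
    | bot => simp at h
    | top => simp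
    | coe r =>
      rw [← EReal.coe_sub, ← EReal.coe_neg]
      simp only [EReal.real_coe_toENNReal]
      have h' : c ≤ r := EReal.coe_le_coe_iff.1 h
      rcases le_total 0 r with hr | hr
      · rw [ENNReal.ofReal_of_nonpos (neg_nonpos.2 hr), add_zero,
          ← ENNReal.ofReal_add hr (neg_nonneg.2 hc), sub_eq_add_neg]
      · rw [ENNReal.ofReal_of_nonpos hr, zero_add,
          ← ENNReal.ofReal_add (sub_nonneg.2 h') (neg_nonneg.2 hr)]
        congr 1
        ring
  have hsum : ∫⁻ x, (f x - c).toENNReal ∂μ + ∫⁻ x, (-f x).toENNReal ∂μ =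
      ∫⁻ x, (f x).toENNReal ∂μ + ENNReal.ofReal (-c) := by
    have hm : Measurable fun x => (-f x).toENNReal := hf.neg.ereal_toENNReal
    rw [← lintegral_add_right _ hm, lintegral_congr hpt,
      lintegral_add_right _ measurable_const, lintegral_const, measure_univ, mul_one]
  rw [extIntegral]
  generalize ∫⁻ x, (f x - c).toENNReal ∂μ = G at *
  generalize ∫⁻ x, (f x).toENNReal ∂μ = P at *
  generalize ∫⁻ x, (-f x).toENNReal ∂μ = N at *
  lift N to ℝ≥0 using (hneg.trans_lt ENNReal.ofReal_lt_top).ne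
  induction P with
  | top =>
    have hG : G = ∞ := by
      rw [top_add, ENNReal.add_eq_top] at hsum
      exact hsum.resolve_right ENNReal.coe_ne_top
    rw [hG]
    rfl
  | coe P =>
    have hG : G ≠ ∞ := fun h => by
      rw [h, top_add] at hsum
      exact ENNReal.add_ne_top.2 ⟨ENNReal.coe_ne_top, ENNReal.ofReal_ne_top⟩ hsum.symm
    lift G to ℝ≥0 using hG
    rw [ENNReal.ofReal] at hsum
    norm_cast at hsum
    have hsum' := congrArg (fun x : ℝ≥0 => (x : ℝ)) hsum
    push_cast at hsum'
    rw [Real.coe_toNNReal _ (neg_nonneg.2 hc)] at hsum'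
    change ((P : ℝ) : EReal) - ((N : ℝ) : EReal) = ((G : ℝ) : EReal) + (c : EReal)
    norm_cast
    linarith

theorem interactionEnergy_eq {n : ℕ} {K : ℝ≥0 → EReal} (hK : LowerSemicontinuous K) {c : ℝ}
    (hc : c ≤ 0) (hKc : ∀ θ, (c : EReal) ≤ K θ) (ρ : ProbabilityMeasure (HypSpace n)) :
    interactionEnergy K ρ = ((1 / 2 : ℝ) : EReal) *
      ((pairEnergy (fun x y => shiftedKernel K c (HypSpace.geodDist x y))
        (ρ : Measure (HypSpace n)) : EReal) + c) := by
  have hm : Measurable fun p : HypSpace n × HypSpace n => K (HypSpace.geodDist p.1 p.2) :=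
    hK.measurable.comp HypSpace.continuous_geodDist.measurable
  rw [interactionEnergy, extIntegral_eq_lintegral_add _ hm hc fun p => hKc _]
  rfl

theorem half_mul_le_iff {a b : EReal} :
    ((1 / 2 : ℝ) : EReal) * a ≤ ((1 / 2 : ℝ) : EReal) * b ↔ a ≤ b := by
  refine ⟨fun h => ?_, fun h => mul_le_mul_of_nonneg_left h (by norm_num)⟩
  have h2 : ((2 : ℝ) : EReal) * ((1 / 2 : ℝ) : EReal) = 1 := by
    rw [← EReal.coe_mul]
    norm_num
  have := mul_le_mul_of_nonneg_left h (by norm_num : (0 : EReal) ≤ ((2 : ℝ) : EReal))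
  rwa [← mul_assoc, ← mul_assoc, h2, one_mul, one_mul] at this

theorem continuous_toENNReal_sub_coe (c : ℝ) : Continuous fun x : EReal => (x - c).toENNReal := by
  refine EReal.continuous_toENNReal.comp (continuous_iff_continuousAt.2 fun x => ?_)
  exact ContinuousAt.comp (f := fun y : EReal => (y, -(c : EReal)))
    (EReal.continuousAt_add (p := (x, -(c : EReal))) (Or.inr (by simp [← EReal.coe_neg]))
    (Or.inr (by simp [← EReal.coe_neg]))) (Continuous.prodMk_left _).continuousAt

theorem lowerSemicontinuous_shiftedKernel {K : ℝ≥0 → EReal} (hK : LowerSemicontinuous K) (c : ℝ) :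
    LowerSemicontinuous (shiftedKernel K c) :=
  (continuous_toENNReal_sub_coe c).comp_lowerSemicontinuous hK fun _ _ hab =>
    EReal.toENNReal_le_toENNReal (EReal.sub_le_sub hab le_rfl)

theorem tendsto_shiftedKernel {K : ℝ≥0 → EReal} {L : EReal} (hK : Tendsto K atTop (𝓝 L)) (c : ℝ) :
    Tendsto (shiftedKernel K c) atTop (𝓝 (L - c).toENNReal) :=
  ((continuous_toENNReal_sub_coe c).tendsto L).comp hK

theorem theorem4p1 (n : ℕ) (hn : 1 ≤ n) (K : ℝ≥0 → EReal)
    (h1 : BoundedFromBelow K)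
    (h2 : LocallyIntegrableOnHyp n K)
    (h4 : HasLimitAndUnstable n K)
    (h5 : LowerSemicontinuous K)
    (h6 : EventuallyStrictlyIncreasing K) :
    (∃ ρ : ProbabilityMeasure (HypSpace n), IsGlobalMinimizer K ρ) ∧
      ∃ D : ℝ, 0 < D ∧ ∀ ρ : ProbabilityMeasure (HypSpace n), IsGlobalMinimizer K ρ →
        IsCompact (ρ : Measure (HypSpace n)).support ∧
          ∀ x ∈ (ρ : Measure (HypSpace n)).support, ∀ y ∈ (ρ : Measure (HypSpace n)).support,
            (HypSpace.geodDist x y : ℝ) ≤ D := by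
  -- Existence and compactness only need the infimum of the energy to lie below the interaction at
  -- infinity; `hn`, `h2` and `h6` are not used.
  obtain ⟨c, hc, hKc⟩ := h1
  obtain ⟨L, hL, ρ₀, hρ₀⟩ := h4
  have hd := HypSpace.isHomogeneousProperDist_geodDist (n := n)
  have hlsc := lowerSemicontinuous_shiftedKernel h5 c
  have hlim := tendsto_shiftedKernel hL c
  have hE := interactionEnergy_eq (n := n) h5 hc.le hKc
  set h := shiftedKernel K c
  have hmin (ρ : ProbabilityMeasure (HypSpace n)) : IsGlobalMinimizer K ρ ↔
      pairEnergy (fun x y => h (HypSpace.geodDist x y)) (ρ : Measure (HypSpace n)) =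
        minPairEnergy fun x y : HypSpace n => h (HypSpace.geodDist x y) := by
    have hle (σ : ProbabilityMeasure (HypSpace n)) :
        interactionEnergy K ρ ≤ interactionEnergy K σ ↔
          pairEnergy (fun x y => h (HypSpace.geodDist x y)) (ρ : Measure (HypSpace n)) ≤
            pairEnergy (fun x y => h (HypSpace.geodDist x y)) (σ : Measure (HypSpace n)) := by
      rw [hE, hE, half_mul_le_iff, (EReal.addLECancellable_coe c).add_le_add_iff_right,
        EReal.coe_ennreal_le_coe_ennreal_iff]
    refine ⟨fun hρ => le_antisymm (le_iInf fun σ => (hle σ).1 (hρ σ)) (minPairEnergy_le _),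
      fun hρ σ => (hle σ).2 (hρ ▸ minPairEnergy_le _)⟩
  have hlt : (minPairEnergy fun x y : HypSpace n => h (HypSpace.geodDist x y)) <
      (L - c).toENNReal := by
    refine (minPairEnergy_le (ρ₀ : Measure (HypSpace n))).trans_lt ?_
    rw [hE, ← not_le, half_mul_le_iff, not_le] at hρ₀
    rw [← EReal.coe_ennreal_lt_coe_ennreal_iff]
    -- `toENNReal` cuts off at zero, which can only raise `L - c`.
    refine lt_of_lt_of_le ?_ (EReal.coe_toENNReal_eq_max.symm ▸ le_max_right 0 _)
    exact EReal.lt_sub_iff_add_lt (by simp) (by simp) |>.2 hρ₀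
  -- The limit may be `∞`; a finite `A` strictly below it is eventually a lower bound for `h`.
  obtain ⟨A, hIA, hAL⟩ := ENNReal.lt_iff_exists_nnreal_btwn.1 hlt
  obtain ⟨I, hI⟩ : ∃ I : ℝ≥0, (I : ℝ≥0∞) = _ :=
    ⟨_, ENNReal.coe_toNNReal (hIA.trans ENNReal.coe_lt_top).ne⟩
  rw [← hI, ENNReal.coe_lt_coe] at hIA
  obtain ⟨t, ht⟩ := (hlim.eventually_const_le hAL).exists_forall_of_atTop
  refine ⟨?_, ?_⟩
  · obtain ⟨ρ, hρ⟩ := hd.exists_pairEnergy_eq_min (HypSpace.vertex n) hlsc hI.symm hIA ht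
    exact ⟨ρ, (hmin ρ).2 (hρ.trans hI)⟩
  · obtain ⟨D, hD0, hD⟩ := hd.exists_support_bound hlsc.measurable hI.symm hIA ht
    refine ⟨D, hD0, fun ρ hρ => ?_⟩
    have hb := hD (ρ : Measure (HypSpace n)) (((hmin ρ).1 hρ).trans hI.symm)
    exact ⟨hd.isCompact_support hb, hb⟩
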